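/- A distribution $p$ on $\{-1,1\}^n$ is a $k$-junta distribution if its probability mass function depends on at most $k$ of the $n$ variables. A general conditional query to $p$ is specified by an arbitrary nonempty set $A\subseteq\{-1,1\}^n$, and the oracle returns a fresh sample $x\sim p$ conditioned on $x\in A$; if $p(A)=0$, the oracle may reply by any fixed convention (for instance with a uniform point of $A$, or with a failure symbol). There are absolute constants $c_1,c_2>0$ such that the following holds for all $n\in\mathbb{N}$, all integers $0<k\le n-1$ and all $0<\varepsilon\le 1/120$. Suppose that a randomized, adaptive algorithm makes at most $q$ general conditional queries to an unknown distribution $p$ on $\{-1,1\}^n$ and outputs a distribution $\hat p$ on $\{-1,1\}^n$, and that for every $k$-junta distribution $p$, with probability at least $4/5$ over the randomness of the algorithm and of the oracle, $d_{\mathrm{TV}}(p,\hat p)=\frac12\sum_x|p(x)-\hat p(x)|\le\varepsilon$. Then $$q\;\ge\; c_1\,\frac{\log_2\binom{n}{k}}{\varepsilon^2}+c_2\,\frac{2^k}{\varepsilon^2}.$$ -/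

import Mathlib

open scoped ENNReal
open MeasureTheory

/-- The hypercube `{-1,1}^n`; the units of `ℤ` are exactly `1` and `-1`. -/
abbrev Cube (n : ℕ) : Type := Fin n → ℤˣ

/-- A distribution on `{-1,1}^n` is a `k`-junta distribution if its probability mass function
depends on at most `k` of the variables. -/
def IsJuntaDist {n : ℕ} (k : ℕ) (p : PMF (Cube n)) : Prop :=
  ∃ J : Finset (Fin n), J.card ≤ k ∧ DependsOn (fun x => p x) (J : Set (Fin n))

/-- Total variation distance between two distributions on `{-1,1}^n`. -/
noncomputable def dTV {n : ℕ} (p q : PMF (Cube n)) : ℝ :=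
  (1 / 2) * ∑ x : Cube n, |(p x).toReal - (q x).toReal|

/-- What an oracle may do when asked to condition on an event of probability zero: `Z p A` is the
distribution of the reply when `A` has probability zero under `p`. The reply may be a point of the
cube (say, a uniform point of `A`) or a failure symbol `none`. -/
abbrev ZeroRule (n : ℕ) : Type := PMF (Cube n) → Finset (Cube n) → PMF (Option (Cube n))

open Classical in
/-- The general conditional sampling oracle for `p`: on a query `A` it returns a sample from `p`
conditioned on `A`; if `A` has probability zero under `p`, it replies according to `Z`. -/
noncomputable def condOracle {n : ℕ} (Z : ZeroRule n) (p : PMF (Cube n)) (A : Finset (Cube n)) :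
    PMF (Option (Cube n)) :=
  if h : ∃ x ∈ (A : Set (Cube n)), x ∈ p.support then
    (p.filter (A : Set (Cube n)) h).map some
  else
    Z p A

/-- A deterministic adaptive algorithm with general conditional queries, as a decision tree.
It either stops with a hypothesis distribution, or queries an arbitrary nonempty set `A` and
continues in a way that depends on the reply. -/
inductive QueryTree (n : ℕ) : Type
  | output (hyp : PMF (Cube n)) : QueryTree n
  | query (A : Finset (Cube n)) (hA : A.Nonempty) (next : Option (Cube n) → QueryTree n) :
      QueryTree n

namespace QueryTree

/-- The worst-case number of queries. -/
def depth {n : ℕ} : QueryTree n → ℕ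
  | output _ => 0
  | query _ _ next => 1 + Finset.univ.sup fun r => (next r).depth

/-- The distribution of the hypothesis that is returned when each query `A` is answered by a fresh
draw from `O A`. -/
noncomputable def run {n : ℕ} (O : Finset (Cube n) → PMF (Option (Cube n))) :
    QueryTree n → PMF (PMF (Cube n))
  | output hyp => PMF.pure hyp
  | query A _ next => (O A).bind fun r => (next r).run O

/-- The probability that the algorithm, when run on `p`, returns a hypothesis within total
variation distance `ε` of `p`. -/
noncomputable def successProb {n : ℕ} (Z : ZeroRule n) (ε : ℝ) (p : PMF (Cube n))
    (T : QueryTree n) : ℝ≥0∞ :=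
  (T.run (condOracle Z p)).toOuterMeasure {hyp | dTV p hyp ≤ ε}

end QueryTree

/-- A randomized algorithm is a random decision tree `alg ω`, where `ω` (the internal randomness)
is drawn from the probability measure `P`. It learns `k`-junta distributions to within `ε` if for
every `k`-junta distribution `p` its hypothesis is `ε`-close to `p` with probability at least `4/5`,
over both its internal randomness and the replies of the oracle. -/
def LearnsJuntas {n : ℕ} {Ω : Type*} [MeasurableSpace Ω] (P : Measure Ω) (Z : ZeroRule n)
    (k : ℕ) (ε : ℝ) (alg : Ω → QueryTree n) : Prop :=
  ∀ p : PMF (Cube n), IsJuntaDist k p → 4 / 5 ≤ ∫⁻ ω, (alg ω).successProb Z ε p ∂P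

/-!
A balanced sign pattern `s` depending on `k` variables gives the `k`-junta distribution
`(1 + δ s) / 2 ^ n`, whose likelihood ratio to the uniform distribution lies between `1 - δ` and
`1 + δ`. Conditioning on a set only rescales these bounds, so whatever the query, the reply has
chi-square divergence at most `(1 - δ ^ 2)⁻¹ - 1` from the reply of the uniform oracle. Writing
`P s` and `U` for the laws of the output after `q` adaptive queries, it follows that
`P s S ^ 2 ≤ (1 - δ ^ 2)⁻¹ ^ q * U S` for every event `S`.

Let `δ` be a suitable multiple of `ε`. In a family of `N` patterns of which at most `L` lie near any
one of them, a hypothesis is `ε`-close to at most `L` of the tilted distributions. Summing over the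
family, successful learning forces `(4 / 5) ^ 2 * N ≤ (1 - δ ^ 2)⁻¹ ^ q * L`. The parities of the
`k`-sets are pairwise at distance `2 ^ n / 2`, so they give `L = 1` and the term `log (n.choose k)`.
The patterns `x i * t (x restricted to J)` with `J.card = k - 1` give `N = 2 ^ 2 ^ (k - 1)` and
`L = (5 / 4) ^ 2 ^ (k - 1)`, the bound for a Hamming ball, and the term `2 ^ k`.
-/

section SecondMoment

variable {α β : Type*}

lemma toOuterMeasure_apply_le_one (p : PMF α) (S : Set α) : p.toOuterMeasure S ≤ 1 :=
  (p.toOuterMeasure.mono S.subset_univ).trans_eq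
    ((p.toOuterMeasure_apply_eq_one_iff _).2 p.support.subset_univ)

lemma toOuterMeasure_apply_ne_top (p : PMF α) (S : Set α) : p.toOuterMeasure S ≠ ∞ :=
  ne_top_of_le_ne_top ENNReal.one_ne_top (toOuterMeasure_apply_le_one p S)

lemma sum_toReal_toOuterMeasure_le {ι : Type*} [Fintype ι] (p : PMF α) (S : ι → Set α)
    [∀ a, DecidablePred fun i => a ∈ S i] {L : ℝ}
    (hL : ∀ a, ((Finset.univ.filter fun i => a ∈ S i).card : ℝ) ≤ L) :
    ∑ i, (p.toOuterMeasure (S i)).toReal ≤ L := by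
  classical
  have hL0 : 0 ≤ L := (Nat.cast_nonneg _).trans (hL p.support_nonempty.some)
  rw [← ENNReal.toReal_sum fun i _ => toOuterMeasure_apply_ne_top p (S i)]
  refine ENNReal.toReal_le_of_le_ofReal hL0 ?_
  calc ∑ i, p.toOuterMeasure (S i)
      = ∑' a, ∑ i, (S i).indicator p a := by
        simp only [PMF.toOuterMeasure_apply]
        rw [← Summable.tsum_finsetSum fun _ _ => ENNReal.summable]
    _ = ∑' a, ((Finset.univ.filter fun i => a ∈ S i).card : ℝ≥0∞) * p a := by
        simp only [Set.indicator_apply, ← Finset.sum_filter, Finset.sum_const, nsmul_eq_mul]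
    _ ≤ ∑' a, ENNReal.ofReal L * p a := by
        gcongr with a
        exact (ENNReal.ofReal_natCast _).symm.trans_le (ENNReal.ofReal_le_ofReal (hL a))
    _ = ENNReal.ofReal L := by rw [ENNReal.tsum_mul_left, p.tsum_coe, mul_one]

lemma toReal_toOuterMeasure_pos {p : PMF α} {A : Set α} (h : ∃ x ∈ A, x ∈ p.support) :
    0 < (p.toOuterMeasure A).toReal := by
  obtain ⟨x, hxA, hx⟩ := h
  refine ENNReal.toReal_pos (fun h0 => ?_) (toOuterMeasure_apply_ne_top p A)
  exact Set.disjoint_left.1 ((p.toOuterMeasure_apply_eq_zero_iff A).1 h0) hx hxA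

lemma toReal_filter_apply (p : PMF α) {A : Set α} (h : ∃ x ∈ A, x ∈ p.support) (x : α) :
    (p.filter A h x).toReal
      = A.indicator (fun y => (p y).toReal) x / (p.toOuterMeasure A).toReal := by
  classical
  rw [PMF.filter_apply, ENNReal.toReal_mul, ENNReal.toReal_inv, ← PMF.toOuterMeasure_apply,
    ← div_eq_mul_inv]
  simp only [Set.indicator_apply, apply_ite ENNReal.toReal, ENNReal.toReal_zero]

variable [Fintype α]

lemma sum_toReal_eq_one (p : PMF α) : ∑ a, (p a).toReal = 1 := by
  rw [← ENNReal.toReal_sum fun a _ => p.apply_ne_top a, (tsum_fintype p).symm.trans p.tsum_coe,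
    ENNReal.toReal_one]

lemma toReal_toOuterMeasure_bind (p : PMF α) (f : α → PMF β) (S : Set β) :
    ((p.bind f).toOuterMeasure S).toReal
      = ∑ a, (p a).toReal * ((f a).toOuterMeasure S).toReal := by
  rw [PMF.toOuterMeasure_bind_apply, tsum_fintype, ENNReal.toReal_sum fun a _ =>
    ENNReal.mul_ne_top (p.apply_ne_top a) (toOuterMeasure_apply_ne_top (f a) S)]
  simp only [ENNReal.toReal_mul]

lemma sum_toReal_map_mul [Fintype β] (p : PMF α) (f : α → β) (g : β → ℝ) :
    ∑ b, (p.map f b).toReal * g b = ∑ a, (p a).toReal * g (f a) := by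
  classical
  have hmap (b : β) : (p.map f b).toReal = ∑ a, if b = f a then (p a).toReal else 0 := by
    rw [PMF.map_apply, tsum_fintype, ENNReal.toReal_sum fun a _ => by
      split_ifs <;> simp [p.apply_ne_top]]
    simp only [apply_ite ENNReal.toReal, ENNReal.toReal_zero]
  simp only [hmap, Finset.sum_mul, ite_mul, zero_mul]
  rw [Finset.sum_comm]
  simp only [Finset.sum_ite_eq', Finset.mem_univ, if_true]

/-- `SecondMomentLE p q M` says that the chi-square divergence of `p` from `q` is at most `M - 1`.
The variational form used here avoids dividing by `q`, and it is the form in which the bound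
propagates through adaptive sampling. -/
def SecondMomentLE (p q : PMF α) (M : ℝ) : Prop :=
  ∀ g : α → ℝ, (∑ a, (p a).toReal * g a) ^ 2 ≤ M * ∑ a, (q a).toReal * g a ^ 2

namespace SecondMomentLE

variable {p q : PMF α} {M a b : ℝ}

lemma map [Fintype β] (h : SecondMomentLE p q M) (f : α → β) :
    SecondMomentLE (p.map f) (q.map f) M := by
  intro g
  rw [sum_toReal_map_mul, sum_toReal_map_mul q f fun b => g b ^ 2]
  exact h fun x => g (f x)

lemma sq_toOuterMeasure_bind_le (h : SecondMomentLE p q M) (hM : 0 ≤ M) {f g : α → PMF β}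
    {S : Set β} {C : ℝ} (hfg : ∀ x,
      ((f x).toOuterMeasure S).toReal ^ 2 ≤ C * ((g x).toOuterMeasure S).toReal) :
    ((p.bind f).toOuterMeasure S).toReal ^ 2
      ≤ M * C * ((q.bind g).toOuterMeasure S).toReal := by
  rw [toReal_toOuterMeasure_bind, toReal_toOuterMeasure_bind]
  calc (∑ x, (p x).toReal * ((f x).toOuterMeasure S).toReal) ^ 2
      ≤ M * ∑ x, (q x).toReal * ((f x).toOuterMeasure S).toReal ^ 2 := h _
    _ ≤ M * ∑ x, (q x).toReal * (C * ((g x).toOuterMeasure S).toReal) := by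
        gcongr with x
        exact hfg x
    _ = M * C * ∑ x, (q x).toReal * ((g x).toOuterMeasure S).toReal := by
        simp only [mul_assoc, Finset.mul_sum, mul_left_comm C]

/-- The Kantorovich inequality: `(p - a q) (b q - p) ≥ 0` bounds `p ^ 2` by a multiple of `q` that
is linear in `p`, and Cauchy–Schwarz does the rest. -/
lemma of_mem_Icc (ha : 0 < a)
    (h : ∀ x, (p x).toReal ∈ Set.Icc (a * (q x).toReal) (b * (q x).toReal)) :
    SecondMomentLE p q ((a + b) ^ 2 / (4 * (a * b))) := by
  intro g
  have hb : 1 ≤ b := by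
    simpa only [← Finset.mul_sum, sum_toReal_eq_one, mul_one] using
      Finset.sum_le_sum fun x (_ : x ∈ Finset.univ) => (h x).2
  have hsum : ∑ x, ((a + b) * (p x).toReal - a * b * (q x).toReal) = a + b - a * b := by
    simp only [Finset.sum_sub_distrib, ← Finset.mul_sum, sum_toReal_eq_one, mul_one]
  have hcs : (∑ x, (p x).toReal * g x) ^ 2
      ≤ (∑ x, ((a + b) * (p x).toReal - a * b * (q x).toReal))
        * ∑ x, (q x).toReal * g x ^ 2 := by
    refine Finset.sum_sq_le_sum_mul_sum_of_sq_le_mul _ (fun x _ => ?_) (fun x _ => by positivity)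
      fun x _ => ?_
    · have hx : b * (a * (q x).toReal) ≤ b * (p x).toReal := by gcongr; exact (h x).1
      have : 0 ≤ a * (p x).toReal := by positivity
      linarith
    · have hx := mul_nonneg (sub_nonneg.2 (h x).1) (sub_nonneg.2 (h x).2)
      nlinarith [mul_nonneg hx (sq_nonneg (g x))]
  rw [hsum] at hcs
  refine hcs.trans (mul_le_mul_of_nonneg_right ?_ (by positivity))
  rw [le_div_iff₀ (show 0 < 4 * (a * b) by positivity)]
  linarith [sq_nonneg (a + b - 2 * (a * b))]

/-- Conditioning rescales both bounds on the likelihood ratio by the same factor, which cancels in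
the Kantorovich constant. -/
lemma filter_of_mem_Icc (ha : 0 < a)
    (h : ∀ x, (p x).toReal ∈ Set.Icc (a * (q x).toReal) (b * (q x).toReal)) {A : Set α}
    (hp : ∃ x ∈ A, x ∈ p.support) (hq : ∃ x ∈ A, x ∈ q.support) :
    SecondMomentLE (p.filter A hp) (q.filter A hq) ((a + b) ^ 2 / (4 * (a * b))) := by
  have hu := toReal_toOuterMeasure_pos hp
  have hv := toReal_toOuterMeasure_pos hq
  set u := (p.toOuterMeasure A).toReal
  set v := (q.toOuterMeasure A).toReal
  have hscale : (a + b) ^ 2 / (4 * (a * b))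
      = (a * (v / u) + b * (v / u)) ^ 2 / (4 * (a * (v / u) * (b * (v / u)))) := by
    rw [← mul_div_mul_right _ _ (pow_pos (div_pos hv hu) 2).ne']
    congr 1 <;> ring
  rw [hscale]
  refine of_mem_Icc (by positivity) fun x => ?_
  rw [toReal_filter_apply, toReal_filter_apply]
  by_cases hx : x ∈ A
  · simp only [Set.indicator_of_mem hx]
    have hcancel (c y : ℝ) : c * (v / u) * (y / v) = c * y / u := by field_simp
    rw [hcancel, hcancel]
    exact ⟨div_le_div_of_nonneg_right (h x).1 hu.le, div_le_div_of_nonneg_right (h x).2 hu.le⟩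
  · simp [hx]

end SecondMomentLE

end SecondMoment

lemma SecondMomentLE.condOracle {n : ℕ} {p q : PMF (Cube n)} {a b : ℝ} (ha : 0 < a)
    (h : ∀ x, (p x).toReal ∈ Set.Icc (a * (q x).toReal) (b * (q x).toReal))
    (hq : ∀ x, q x ≠ 0) (Z : ZeroRule n) {A : Finset (Cube n)} (hA : A.Nonempty) :
    SecondMomentLE (condOracle Z p A) (condOracle Z q A) ((a + b) ^ 2 / (4 * (a * b))) := by
  obtain ⟨x, hx⟩ := hA
  have hpx : p x ≠ 0 := fun h0 => by
    have := (h x).1.trans_eq (by rw [h0, ENNReal.toReal_zero])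
    exact this.not_gt (mul_pos ha (ENNReal.toReal_pos (hq x) (q.apply_ne_top x)))
  have hp' : ∃ x ∈ (A : Set (Cube n)), x ∈ p.support := ⟨x, hx, hpx⟩
  have hq' : ∃ x ∈ (A : Set (Cube n)), x ∈ q.support := ⟨x, hx, hq x⟩
  rw [_root_.condOracle, _root_.condOracle, dif_pos hp', dif_pos hq']
  exact (filter_of_mem_Icc ha h hp' hq').map some

namespace QueryTree

variable {n : ℕ}

lemma sq_toOuterMeasure_run_le {O O' : Finset (Cube n) → PMF (Option (Cube n))} {M : ℝ}
    (hM : 1 ≤ M) (hO : ∀ A : Finset (Cube n), A.Nonempty → SecondMomentLE (O A) (O' A) M)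
    (S : Set (PMF (Cube n))) (T : QueryTree n) {q : ℕ} (hq : T.depth ≤ q) :
    ((T.run O).toOuterMeasure S).toReal ^ 2
      ≤ M ^ q * ((T.run O').toOuterMeasure S).toReal := by
  classical
  induction T generalizing q with
  | output hyp =>
    have hMq : 1 ≤ M ^ q := one_le_pow₀ hM
    simp only [run, PMF.toOuterMeasure_pure_apply]
    split_ifs
    · simpa using hMq
    · simp
  | query A hA next ih =>
    obtain _ | q := q
    · simp [depth] at hq
    have hnext (r : Option (Cube n)) : (next r).depth ≤ q := by
      have := Finset.le_sup (f := fun r => (next r).depth) (Finset.mem_univ r)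
      simp only [depth] at hq
      omega
    rw [pow_succ' M]
    exact (hO A hA).sq_toOuterMeasure_bind_le (zero_le_one.trans hM) fun r => ih r (hnext r)

lemma sq_sum_toOuterMeasure_run_le {ι : Type*} [Fintype ι]
    {O : ι → Finset (Cube n) → PMF (Option (Cube n))}
    {O' : Finset (Cube n) → PMF (Option (Cube n))} {M L : ℝ} (hM : 1 ≤ M)
    (hO : ∀ i, ∀ A : Finset (Cube n), A.Nonempty → SecondMomentLE (O i A) (O' A) M)
    (S : ι → Set (PMF (Cube n))) [∀ hyp, DecidablePred fun i => hyp ∈ S i]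
    (hL : ∀ hyp, ((Finset.univ.filter fun i => hyp ∈ S i).card : ℝ) ≤ L)
    (T : QueryTree n) {q : ℕ} (hq : T.depth ≤ q) :
    (∑ i, ((T.run (O i)).toOuterMeasure (S i)).toReal) ^ 2
      ≤ Fintype.card ι * (M ^ q * L) :=
  calc (∑ i, ((T.run (O i)).toOuterMeasure (S i)).toReal) ^ 2
      ≤ Fintype.card ι * ∑ i, ((T.run (O i)).toOuterMeasure (S i)).toReal ^ 2 :=
        sq_sum_le_card_mul_sum_sq
    _ ≤ Fintype.card ι * ∑ i, M ^ q * ((T.run O').toOuterMeasure (S i)).toReal := by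
        gcongr with i
        exact sq_toOuterMeasure_run_le hM (hO i) (S i) T hq
    _ ≤ Fintype.card ι * (M ^ q * L) := by
        rw [← Finset.mul_sum]
        gcongr
        exact sum_toReal_toOuterMeasure_le (T.run O') S hL

end QueryTree

lemma sum_lintegral_le_lintegral_sum {Ω ι : Type*} [MeasurableSpace Ω] (P : Measure Ω)
    (f : ι → Ω → ℝ≥0∞) (s : Finset ι) :
    ∑ i ∈ s, ∫⁻ ω, f i ω ∂P ≤ ∫⁻ ω, ∑ i ∈ s, f i ω ∂P := by
  classical
  induction s using Finset.induction_on with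
  | empty => simp
  | insert i s hi ih =>
    simp only [Finset.sum_insert hi]
    exact (add_le_add_right ih _).trans (le_lintegral_add _ _)

/-- The first moment method derandomizes the algorithm. -/
lemma LearnsJuntas.exists_le_sum_toReal_successProb {n k : ℕ} {ε : ℝ} {Z : ZeroRule n}
    {Ω : Type*} [MeasurableSpace Ω] {P : Measure Ω} [IsProbabilityMeasure P]
    {alg : Ω → QueryTree n} (h : LearnsJuntas P Z k ε alg) {ι : Type*} [Fintype ι]
    {p : ι → PMF (Cube n)} (hp : ∀ i, IsJuntaDist k (p i)) :
    ∃ ω, Fintype.card ι * (4 / 5 : ℝ) ≤ ∑ i, ((alg ω).successProb Z ε (p i)).toReal := by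
  let total (ω : Ω) : ℝ≥0∞ := ∑ i, (alg ω).successProb Z ε (p i)
  have hfin : ∫⁻ ω, total ω ∂P ≠ ∞ := by
    refine ne_top_of_le_ne_top (ENNReal.natCast_ne_top (Fintype.card ι)) ?_
    calc ∫⁻ ω, total ω ∂P
        ≤ ∫⁻ _, Fintype.card ι ∂P := lintegral_mono fun ω =>
          (Finset.sum_le_card_nsmul Finset.univ _ 1
            fun i _ => toOuterMeasure_apply_le_one _ _).trans_eq (by simp)
      _ = Fintype.card ι := by simp
  obtain ⟨ω, hω⟩ := exists_lintegral_le hfin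
  have hmean : Fintype.card ι * (4 / 5 : ℝ≥0∞) ≤ total ω :=
    calc Fintype.card ι * (4 / 5 : ℝ≥0∞)
        = ∑ _i : ι, (4 / 5 : ℝ≥0∞) := by simp
      _ ≤ ∑ i, ∫⁻ ω, (alg ω).successProb Z ε (p i) ∂P := Finset.sum_le_sum fun i _ => h (p i) (hp i)
      _ ≤ ∫⁻ ω, total ω ∂P := sum_lintegral_le_lintegral_sum P _ Finset.univ
      _ ≤ total ω := hω
  have hne (i : ι) : (alg ω).successProb Z ε (p i) ≠ ∞ := toOuterMeasure_apply_ne_top _ _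
  refine ⟨ω, ?_⟩
  rw [← ENNReal.toReal_sum fun i _ => hne i]
  simpa [ENNReal.toReal_div] using
    ENNReal.toReal_mono (ENNReal.sum_ne_top.2 fun i _ => hne i) hmean

/-- A sign pattern is balanced if it takes the values `1` and `-1` equally often. -/
def IsBalanced {α : Type*} [Fintype α] (s : α → ℤˣ) : Prop := ∑ x, (s x : ℤ) = 0

section Signs

variable {α : Type*} [Fintype α] {s t : α → ℤˣ}

lemma IsBalanced.of_equiv (e : α ≃ α) (h : ∀ x, s (e x) = -s x) : IsBalanced s := by
  have hneg : ∑ x, (s x : ℤ) = -∑ x, (s x : ℤ) := by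
    rw [← Finset.sum_neg_distrib, ← Equiv.sum_comp e fun x => (s x : ℤ)]
    simp only [h, Units.val_neg]
  unfold IsBalanced
  lia

lemma IsBalanced.sum_cast_eq_zero (hs : IsBalanced s) : ∑ x, ((s x : ℤ) : ℝ) = 0 := by
  exact_mod_cast hs

lemma sum_mul_eq_card_sub_hammingDist (s t : α → ℤˣ) :
    ∑ x, ((s x * t x : ℤˣ) : ℤ) = Fintype.card α - 2 * hammingDist s t := by
  have hterm (x : α) : ((s x * t x : ℤˣ) : ℤ) = 1 - 2 * if s x ≠ t x then 1 else 0 := by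
    rcases Int.units_eq_one_or (s x) with hs | hs <;>
      rcases Int.units_eq_one_or (t x) with ht | ht <;> simp [hs, ht]
  simp only [hterm, Finset.sum_sub_distrib, ← Finset.mul_sum, Finset.sum_boole, hammingDist]
  simp

lemma IsBalanced.two_mul_hammingDist (h : IsBalanced fun x => s x * t x) :
    2 * hammingDist s t = Fintype.card α := by
  have := (sum_mul_eq_card_sub_hammingDist s t).symm.trans h
  lia

lemma sum_abs_sub_eq_two_mul_hammingDist (s t : α → ℤˣ) :
    ∑ x, |((s x : ℤ) : ℝ) - (t x : ℤ)| = 2 * hammingDist s t := by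
  have hterm (x : α) : |((s x : ℤ) : ℝ) - (t x : ℤ)| = 2 * if s x ≠ t x then 1 else 0 := by
    rcases Int.units_eq_one_or (s x) with hs | hs <;>
      rcases Int.units_eq_one_or (t x) with ht | ht <;> norm_num [hs, ht]
  simp only [hterm, ← Finset.mul_sum, Finset.sum_boole, hammingDist]

end Signs

section Tilt

variable {n : ℕ}

lemma abs_mul_intUnit (δ : ℝ) (u : ℤˣ) : |δ * (u : ℤ)| = |δ| := by
  rcases Int.units_eq_one_or u with rfl | rfl <;> simp

lemma one_add_mul_intUnit_nonneg {δ : ℝ} (hδ : |δ| ≤ 1) (u : ℤˣ) : 0 ≤ 1 + δ * (u : ℤ) := by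
  have := neg_abs_le (δ * (u : ℤ))
  rw [abs_mul_intUnit] at this
  linarith

/-- The perturbation `(1 + δ s) / 2 ^ n` of the uniform distribution by a balanced sign pattern. -/
noncomputable def tilt (s : Cube n → ℤˣ) (hs : IsBalanced s) (δ : ℝ) (hδ : |δ| ≤ 1) :
    PMF (Cube n) :=
  PMF.ofFintype (fun x => ENNReal.ofReal ((1 + δ * (s x : ℤ)) / 2 ^ n)) <| by
    rw [← ENNReal.ofReal_sum_of_nonneg
      fun x _ => div_nonneg (one_add_mul_intUnit_nonneg hδ (s x)) (by positivity),
      ← Finset.sum_div, Finset.sum_add_distrib, ← Finset.mul_sum, hs.sum_cast_eq_zero]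
    simp

variable {s t : Cube n → ℤˣ} (hs : IsBalanced s) (ht : IsBalanced t) {δ : ℝ}

lemma toReal_tilt_apply (hδ : |δ| ≤ 1) (x : Cube n) :
    (tilt s hs δ hδ x).toReal = (1 + δ * (s x : ℤ)) / 2 ^ n :=
  ENNReal.toReal_ofReal (div_nonneg (one_add_mul_intUnit_nonneg hδ (s x)) (by positivity))

lemma isJuntaDist_tilt (hδ : |δ| ≤ 1) {k : ℕ} {J : Finset (Fin n)} (hJ : J.card ≤ k)
    (hsJ : DependsOn s J) : IsJuntaDist k (tilt s hs δ hδ) :=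
  ⟨J, hJ, fun x y hxy => by simp only [tilt, PMF.ofFintype_apply, hsJ hxy]⟩

lemma dTV_tilt (hδ : |δ| ≤ 1) :
    dTV (tilt s hs δ hδ) (tilt t ht δ hδ) = |δ| * hammingDist s t / 2 ^ n := by
  have hterm (x : Cube n) : |(tilt s hs δ hδ x).toReal - (tilt t ht δ hδ x).toReal|
      = |δ| / 2 ^ n * |((s x : ℤ) : ℝ) - (t x : ℤ)| := by
    rw [toReal_tilt_apply, toReal_tilt_apply, ← sub_div, add_sub_add_left_eq_sub, ← mul_sub,
      abs_div, abs_mul, abs_of_pos (show (0 : ℝ) < 2 ^ n by positivity), div_mul_eq_mul_div]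
  simp only [dTV, hterm, ← Finset.mul_sum, sum_abs_sub_eq_two_mul_hammingDist]
  ring

lemma dTV_comm (p q : PMF (Cube n)) : dTV p q = dTV q p := by
  simp only [dTV, abs_sub_comm]

lemma dTV_triangle (p q r : PMF (Cube n)) : dTV p r ≤ dTV p q + dTV q r := by
  simp only [dTV, ← mul_add, ← Finset.sum_add_distrib]
  gcongr
  exact abs_sub_le _ _ _

lemma mul_hammingDist_le_of_dTV_le (hδ : |δ| ≤ 1) {ε : ℝ} {r : PMF (Cube n)}
    (hsr : dTV (tilt s hs δ hδ) r ≤ ε) (htr : dTV (tilt t ht δ hδ) r ≤ ε) :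
    |δ| * hammingDist s t ≤ 2 * ε * 2 ^ n := by
  have h := dTV_triangle (tilt s hs δ hδ) r (tilt t ht δ hδ)
  rw [dTV_comm r, dTV_tilt, div_le_iff₀ (by positivity)] at h
  refine h.trans ?_
  gcongr
  linarith

lemma secondMomentLE_condOracle_tilt (hδ : |δ| < 1) (Z : ZeroRule n) {A : Finset (Cube n)}
    (hA : A.Nonempty) :
    SecondMomentLE (condOracle Z (tilt s hs δ hδ.le) A)
      (condOracle Z (PMF.uniformOfFintype (Cube n)) A) (1 - δ ^ 2)⁻¹ := by
  have hratio (x : Cube n) : (tilt s hs δ hδ.le x).toReal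
      ∈ Set.Icc ((1 - |δ|) * (PMF.uniformOfFintype (Cube n) x).toReal)
        ((1 + |δ|) * (PMF.uniformOfFintype (Cube n) x).toReal) := by
    have hx := abs_le.1 (abs_mul_intUnit δ (s x)).le
    have huniform : (PMF.uniformOfFintype (Cube n) x).toReal = 1 / 2 ^ n := by simp
    rw [toReal_tilt_apply, huniform, mul_one_div, mul_one_div]
    exact ⟨by gcongr; linarith, by gcongr; linarith⟩
  have hconst : (1 - δ ^ 2)⁻¹
      = ((1 - |δ|) + (1 + |δ|)) ^ 2 / (4 * ((1 - |δ|) * (1 + |δ|))) := by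
    rw [← sq_abs δ, inv_eq_one_div, ← mul_div_mul_left 1 _ four_ne_zero]
    congr 1 <;> ring
  rw [hconst]
  exact SecondMomentLE.condOracle (sub_pos.2 hδ) hratio
    (fun x => by simp) Z hA

end Tilt

section Parity

variable {n : ℕ} {J K : Finset (Fin n)}

/-- The character of the cube given by the product of the coordinates in `J`. -/
def parity (J : Finset (Fin n)) (x : Cube n) : ℤˣ := ∏ i ∈ J, x i

lemma parity_mul (J : Finset (Fin n)) (x y : Cube n) :
    parity J (x * y) = parity J x * parity J y :=
  Finset.prod_mul_distrib

lemma parity_mulSingle (J : Finset (Fin n)) (i : Fin n) :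
    parity J (Pi.mulSingle i (-1)) = if i ∈ J then -1 else 1 := by
  simp [parity, Pi.mulSingle_apply, Finset.prod_ite_eq']

lemma dependsOn_parity (J : Finset (Fin n)) : DependsOn (parity J) J :=
  fun _ _ h => Finset.prod_congr rfl fun i hi => h i hi

lemma isBalanced_parity (hJ : J.Nonempty) : IsBalanced (parity J) := by
  obtain ⟨i, hi⟩ := hJ
  refine .of_equiv (Equiv.mulLeft (Pi.mulSingle i (-1))) fun x => ?_
  rw [Equiv.coe_mulLeft, parity_mul, parity_mulSingle, if_pos hi, neg_one_mul]

lemma isBalanced_parity_mul (h : ¬J ⊆ K) : IsBalanced fun x => parity J x * parity K x := by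
  obtain ⟨i, hiJ, hiK⟩ := Finset.not_subset.1 h
  refine .of_equiv (Equiv.mulLeft (Pi.mulSingle i (-1))) fun x => ?_
  simp only [Equiv.coe_mulLeft, parity_mul, parity_mulSingle, if_pos hiJ, if_neg hiK, one_mul,
    neg_mul]

lemma two_mul_hammingDist_parity (h : ¬J ⊆ K) :
    2 * hammingDist (parity J) (parity K) = 2 ^ n := by
  rw [(isBalanced_parity_mul h).two_mul_hammingDist]
  simp

end Parity

section SignedPattern

variable {n : ℕ} {J : Finset (Fin n)} {i : Fin n}

/-- The sign pattern `x ↦ x i * t (x restricted to J)`, which depends on `insert i J`. For `i ∉ J`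
the factor `x i` makes it balanced, whatever `t` is. -/
def signedPattern (i : Fin n) (t : (J → ℤˣ) → ℤˣ) (x : Cube n) : ℤˣ := x i * t (J.restrict x)

lemma dependsOn_signedPattern (i : Fin n) (t : (J → ℤˣ) → ℤˣ) :
    DependsOn (signedPattern i t) (insert i J : Finset (Fin n)) := fun x y h => by
  have hrestrict : J.restrict x = J.restrict y :=
    funext fun j => h j (Finset.mem_insert_of_mem j.2)
  rw [signedPattern, signedPattern, hrestrict, h i (Finset.mem_insert_self i J)]

lemma isBalanced_signedPattern (hi : i ∉ J) (t : (J → ℤˣ) → ℤˣ) :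
    IsBalanced (signedPattern i t) := by
  refine .of_equiv (Equiv.mulLeft (Pi.mulSingle i (-1))) fun x => ?_
  have hrestrict : J.restrict (Pi.mulSingle i (-1) * x) = J.restrict x := by
    funext j
    simp [Finset.restrict, Pi.mulSingle_eq_of_ne (ne_of_mem_of_not_mem j.2 hi)]
  simp [signedPattern, hrestrict]

lemma card_filter_restrict_mul {ι β : Type*} [Fintype ι] [DecidableEq ι] [Fintype β]
    (J : Finset ι) (p : (J → β) → Prop) [DecidablePred p] :
    (Finset.univ.filter fun x : ι → β => p (J.restrict x)).card * Fintype.card β ^ J.card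
      = Fintype.card β ^ Fintype.card ι * (Finset.univ.filter p).card := by
  have hsplit : (Finset.univ.filter fun x : ι → β => p (J.restrict x)).card
      = (Finset.univ.filter p).card * Fintype.card ({j // j ∉ J} → β) := by
    rw [← Finset.card_univ, ← Finset.card_product]
    refine Finset.card_equiv (Equiv.piEquivPiSubtypeProd (· ∈ J) fun _ => β) fun x => ?_
    simp only [Finset.mem_product, Finset.mem_filter, Finset.mem_univ, true_and, and_true]
    rfl
  have htotal : Fintype.card β ^ J.card * Fintype.card ({j // j ∉ J} → β)
      = Fintype.card β ^ Fintype.card ι := by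
    rw [Fintype.card_fun, ← pow_add, Fintype.card_subtype_compl, Fintype.card_coe,
      Nat.add_sub_cancel' J.card_le_univ]
  rw [hsplit, ← htotal]
  ring

lemma hammingDist_signedPattern_mul (i : Fin n) (t t' : (J → ℤˣ) → ℤˣ) :
    hammingDist (signedPattern i t) (signedPattern i t') * 2 ^ J.card
      = 2 ^ n * hammingDist t t' := by
  have hcancel : hammingDist (signedPattern i t) (signedPattern i t')
      = hammingDist (fun x : Cube n => t (J.restrict x)) fun x => t' (J.restrict x) :=
    hammingDist_comp (fun (x : Cube n) u => x i * u) fun x => mul_right_injective (x i)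
  rw [hcancel]
  simpa only [hammingDist, Fintype.card_units_int, Fintype.card_fin] using
    card_filter_restrict_mul (β := ℤˣ) J fun y => t y ≠ t' y

end SignedPattern

section HammingBall

variable {Y β : Type*} [Fintype Y] [DecidableEq Y] [Fintype β] [DecidableEq β]

lemma sum_pow_hammingDist {R : Type*} [CommRing R] (t₀ : Y → β) (z : R) :
    ∑ t : Y → β, z ^ hammingDist t t₀ = (1 + (Fintype.card β - 1) * z) ^ Fintype.card Y := by
  have hprod (t : Y → β) : z ^ hammingDist t t₀ = ∏ y, if t y = t₀ y then 1 else z := by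
    rw [Finset.prod_ite, Finset.prod_const_one, Finset.prod_const, one_mul, hammingDist]
  have hsum (y : Y) : ∑ v, (if v = t₀ y then 1 else z) = 1 + (Fintype.card β - 1) * z := by
    rw [← Finset.add_sum_erase _ _ (Finset.mem_univ (t₀ y)), if_pos rfl]
    rw [Finset.sum_congr rfl fun v hv => if_neg (Finset.ne_of_mem_erase hv), Finset.sum_const,
      nsmul_eq_mul, Finset.cast_card_erase_of_mem (Finset.mem_univ _), Finset.card_univ]
  simp only [hprod, ← Fintype.prod_sum fun y v => if v = t₀ y then (1 : R) else z, hsum,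
    Finset.prod_const, Finset.card_univ]

lemma card_hammingBall_mul_pow_le (t₀ : Y → β) (r : ℕ) {z : ℝ} (hz0 : 0 ≤ z) (hz1 : z ≤ 1) :
    (Finset.univ.filter fun t : Y → β => hammingDist t t₀ ≤ r).card * z ^ r
      ≤ (1 + (Fintype.card β - 1) * z) ^ Fintype.card Y := by
  rw [← nsmul_eq_mul, ← Finset.sum_const, ← sum_pow_hammingDist t₀ z]
  calc ∑ t with hammingDist t t₀ ≤ r, z ^ r
      ≤ ∑ t with hammingDist t t₀ ≤ r, z ^ hammingDist t t₀ :=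
        Finset.sum_le_sum fun t ht =>
          pow_le_pow_of_le_one hz0 hz1 (Finset.mem_filter.1 ht).2
    _ ≤ ∑ t, z ^ hammingDist t t₀ :=
        Finset.sum_le_univ_sum_of_nonneg fun t => pow_nonneg hz0 _

/-- The weight is `z = 1 / 8` and the radius is `m / 30`: then `z ^ (-1 / 30) ≤ 10 / 9`, and
`(1 + z) * (10 / 9) = 5 / 4`. -/
lemma card_hammingBall_le (t₀ : Y → ℤˣ) :
    ((Finset.univ.filter fun t : Y → ℤˣ => 30 * hammingDist t t₀ ≤ Fintype.card Y).card : ℝ)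
      ≤ (5 / 4) ^ Fintype.card Y := by
  set m := Fintype.card Y
  have hball := card_hammingBall_mul_pow_le t₀ (m / 30) (z := 1 / 8) (by norm_num) (by norm_num)
  have hradius : ((10 / 9 : ℝ) ^ m)⁻¹ ≤ (1 / 8) ^ (m / 30) := by
    rw [one_div, inv_pow]
    refine inv_anti₀ (by positivity) ?_
    calc (8 : ℝ) ^ (m / 30) ≤ ((10 / 9) ^ 30) ^ (m / 30) := by gcongr; norm_num
      _ = (10 / 9) ^ (30 * (m / 30)) := (pow_mul _ _ _).symm
      _ ≤ (10 / 9) ^ m := by gcongr; exacts [by norm_num, Nat.mul_div_le m 30]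
  simp only [Nat.le_div_iff_mul_le (show 0 < 30 by norm_num), mul_comm _ 30,
    Fintype.card_units_int] at hball
  have hle := (mul_le_mul_of_nonneg_left hradius (Nat.cast_nonneg _)).trans hball
  rw [← div_eq_mul_inv, div_le_iff₀ (by positivity), ← mul_pow] at hle
  norm_num at hle ⊢
  exact hle

end HammingBall

lemma inv_one_sub_sq_le_exp {δ : ℝ} (hδ : |δ| ≤ 1 / 2) :
    (1 - δ ^ 2)⁻¹ ≤ Real.exp (4 / 3 * δ ^ 2) := by
  have hδ2 : δ ^ 2 ≤ (1 / 2) ^ 2 := sq_le_sq' (abs_le.1 hδ).1 (abs_le.1 hδ).2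
  refine le_trans ?_ (Real.add_one_le_exp _)
  rw [inv_le_iff_one_le_mul₀ (by linarith)]
  nlinarith [sq_nonneg δ]

section Learning

variable {n k q : ℕ} {ε : ℝ} {Z : ZeroRule n} {Ω : Type*} [MeasurableSpace Ω] {P : Measure Ω}
  [IsProbabilityMeasure P] {alg : Ω → QueryTree n}

lemma card_le_of_learnsJuntas (hq : ∀ ω, (alg ω).depth ≤ q) (hlearn : LearnsJuntas P Z k ε alg)
    {δ : ℝ} (hδ : |δ| < 1) {ι : Type*} [Fintype ι] {s : ι → Cube n → ℤˣ}
    (hs : ∀ i, IsBalanced (s i)) (hJ : ∀ i, ∃ J : Finset (Fin n), J.card ≤ k ∧ DependsOn (s i) J)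
    {L : ℝ} (hL0 : 0 ≤ L) (hL : ∀ i, ((Finset.univ.filter fun j =>
      |δ| * hammingDist (s j) (s i) ≤ 2 * ε * 2 ^ n).card : ℝ) ≤ L) :
    16 * (Fintype.card ι : ℝ) ≤ 25 * ((1 - δ ^ 2)⁻¹ ^ q * L) := by
  classical
  let p (i : ι) : PMF (Cube n) := tilt (s i) (hs i) δ hδ.le
  have hoverlap (hyp : PMF (Cube n)) :
      ((Finset.univ.filter fun i => hyp ∈ {r | dTV (p i) r ≤ ε}).card : ℝ) ≤ L := by
    obtain hempty | ⟨i, hi⟩ :=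
      (Finset.univ.filter fun i => hyp ∈ {r | dTV (p i) r ≤ ε}).eq_empty_or_nonempty
    · simpa only [hempty, Finset.card_empty, Nat.cast_zero] using hL0
    · refine le_trans ?_ (hL i)
      gcongr with j
      exact fun hj => mul_hammingDist_le_of_dTV_le _ _ hδ.le hj (Finset.mem_filter.1 hi).2
  have hM : 1 ≤ (1 - δ ^ 2)⁻¹ :=
    (one_le_inv₀ (sub_pos.2 ((sq_lt_one_iff_abs_lt_one δ).2 hδ))).2 (by linarith [sq_nonneg δ])
  obtain ⟨ω, hω⟩ := hlearn.exists_le_sum_toReal_successProb (p := p) fun i =>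
    let ⟨_, hcard, hdep⟩ := hJ i
    isJuntaDist_tilt (hs i) hδ.le hcard hdep
  have hsq := QueryTree.sq_sum_toOuterMeasure_run_le (O := fun i => condOracle Z (p i)) hM
    (fun i _ hA => secondMomentLE_condOracle_tilt (hs i) hδ Z hA) _ hoverlap (alg ω) (hq ω)
  obtain hι | hι := (Nat.cast_nonneg (α := ℝ) (Fintype.card ι)).eq_or_lt
  · rw [← hι, mul_zero]
    positivity
  · refine le_of_mul_le_mul_left ?_ hι
    have := (pow_le_pow_left₀ (by positivity) hω 2).trans hsq
    linarith

/-- The choice `δ = 60 ε` in `card_le_of_learnsJuntas`, so that `4800 * ε ^ 2 = 4 / 3 * δ ^ 2`. -/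
lemma card_le_exp_of_learnsJuntas (hε : 0 < ε) (hε' : ε ≤ 1 / 120) (hq : ∀ ω, (alg ω).depth ≤ q)
    (hlearn : LearnsJuntas P Z k ε alg) {ι : Type*} [Fintype ι] {s : ι → Cube n → ℤˣ}
    (hs : ∀ i, IsBalanced (s i)) (hJ : ∀ i, ∃ J : Finset (Fin n), J.card ≤ k ∧ DependsOn (s i) J)
    {L : ℝ} (hL0 : 0 ≤ L) (hL : ∀ i, ((Finset.univ.filter fun j =>
      30 * hammingDist (s j) (s i) ≤ 2 ^ n).card : ℝ) ≤ L) :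
    16 * (Fintype.card ι : ℝ) ≤ 25 * (Real.exp (4800 * ε ^ 2 * q) * L) := by
  have habs : |60 * ε| = 60 * ε := abs_of_pos (by positivity)
  have hδ : |60 * ε| ≤ 1 / 2 := by linarith
  have hclose (d : ℕ) : |60 * ε| * d ≤ 2 * ε * 2 ^ n ↔ 30 * d ≤ 2 ^ n := by
    rw [habs, show 60 * ε * d = 2 * ε * (30 * d) by ring, mul_le_mul_iff_right₀ (by positivity)]
    exact_mod_cast Iff.rfl
  have hM : ((1 - (60 * ε) ^ 2)⁻¹) ^ q ≤ Real.exp (4800 * ε ^ 2 * q) := by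
    rw [mul_comm _ (q : ℝ), Real.exp_nat_mul]
    refine pow_le_pow_left₀ (inv_nonneg.2 ?_) ((inv_one_sub_sq_le_exp hδ).trans_eq ?_) q
    · nlinarith
    · ring_nf
  refine (card_le_of_learnsJuntas hq hlearn (hδ.trans_lt (by norm_num)) hs hJ hL0 ?_).trans ?_
  · simpa only [hclose] using hL
  · gcongr

lemma choose_le_exp_of_learnsJuntas (hk : 0 < k) (hε : 0 < ε) (hε' : ε ≤ 1 / 120)
    (hq : ∀ ω, (alg ω).depth ≤ q) (hlearn : LearnsJuntas P Z k ε alg) :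
    16 * (n.choose k : ℝ) ≤ 25 * Real.exp (4800 * ε ^ 2 * q) := by
  let s (J : {J : Finset (Fin n) // J.card = k}) : Cube n → ℤˣ := parity J.1
  have hsep (J : {J : Finset (Fin n) // J.card = k}) :
      ((Finset.univ.filter fun K => 30 * hammingDist (s K) (s J) ≤ 2 ^ n).card : ℝ) ≤ 1 := by
    refine Nat.cast_le_one.2
      ((Finset.card_le_card (t := {J}) fun K hK => ?_).trans_eq (Finset.card_singleton J))
    by_contra hne
    have hsub : ¬K.1 ⊆ J.1 := fun h =>
      hne (Finset.mem_singleton.2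
        (Subtype.ext (Finset.eq_of_subset_of_card_le h (J.2.trans K.2.symm).le)))
    have hfar := two_mul_hammingDist_parity hsub
    have hnear : 30 * hammingDist (parity K.1) (parity J.1) ≤ 2 ^ n := (Finset.mem_filter.1 hK).2
    have : 0 < 2 ^ n := by positivity
    lia
  simpa using card_le_exp_of_learnsJuntas hε hε' hq hlearn (s := s)
    (fun J => isBalanced_parity (Finset.card_pos.1 (hk.trans_eq J.2.symm)))
    (fun J => ⟨J, J.2.le, dependsOn_parity J.1⟩) zero_le_one hsep

lemma pow_two_pow_le_exp_of_learnsJuntas (hk : 0 < k) (hkn : k ≤ n) (hε : 0 < ε)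
    (hε' : ε ≤ 1 / 120) (hq : ∀ ω, (alg ω).depth ≤ q) (hlearn : LearnsJuntas P Z k ε alg) :
    16 * (8 / 5 : ℝ) ^ 2 ^ (k - 1) ≤ 25 * Real.exp (4800 * ε ^ 2 * q) := by
  obtain ⟨K, -, hK⟩ := Finset.exists_subset_card_eq
    (s := (Finset.univ : Finset (Fin n))) (n := k) (by simpa using hkn)
  obtain ⟨i, hi⟩ := Finset.card_pos.1 (hk.trans_eq hK.symm)
  set J := K.erase i
  have hJ : J.card = k - 1 := by rw [Finset.card_erase_of_mem hi, hK]
  have hm : Fintype.card (J → ℤˣ) = 2 ^ (k - 1) := by simp [hJ]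
  have hsep (t₀ : (J → ℤˣ) → ℤˣ) :
      ((Finset.univ.filter fun t : (J → ℤˣ) → ℤˣ =>
        30 * hammingDist (signedPattern i t) (signedPattern i t₀) ≤ 2 ^ n).card : ℝ)
        ≤ (5 / 4) ^ 2 ^ (k - 1) := by
    have hball := card_hammingBall_le t₀
    rw [hm] at hball
    refine le_trans (Nat.cast_le.2 (Finset.card_le_card
      (Finset.monotone_filter_right _ fun t _ ht => ?_))) hball
    refine Nat.le_of_mul_le_mul_left ?_ (show 0 < 2 ^ n by positivity)
    rw [mul_left_comm, ← hammingDist_signedPattern_mul, hJ, ← mul_assoc]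
    gcongr
  have hcard := card_le_exp_of_learnsJuntas hε hε' hq hlearn
    (fun t => isBalanced_signedPattern (K.notMem_erase i) t)
    (fun t => ⟨insert i J, by rw [Finset.insert_erase hi, hK], dependsOn_signedPattern i t⟩)
    (by positivity) hsep
  rw [Fintype.card_fun, hm, Fintype.card_units_int, ← mul_assoc, ← div_le_iff₀ (by positivity)]
    at hcard
  refine le_trans (le_of_eq ?_) hcard
  rw [mul_div_assoc, Nat.cast_pow, ← div_pow]
  norm_num

end Learning

lemma logb_two_le_of_mul_le_mul_exp {N : ℕ} {x : ℝ} (hx : 0 ≤ x)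
    (h : 16 * (N : ℝ) ≤ 25 * Real.exp x) : Real.logb 2 N ≤ 6 * x := by
  obtain hN | hN := Nat.lt_or_ge N 2
  · have : Real.logb 2 N ≤ 0 :=
      (Real.logb_nonpos_iff' one_lt_two N.cast_nonneg).2 (by exact_mod_cast Nat.le_of_lt_succ hN)
    linarith
  have hN2 : (2 : ℝ) ≤ N := by exact_mod_cast hN
  have hcube : (N : ℝ) ≤ Real.exp (3 * x) := by
    have hpow : (16 / 25 * N : ℝ) ^ 3 ≤ Real.exp x ^ 3 := by gcongr; linarith
    have hsq : (2 : ℝ) ^ 2 * N ≤ N ^ 2 * N := by gcongr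
    rw [show 3 * x = (3 : ℕ) * x by norm_num, Real.exp_nat_mul]
    nlinarith
  have hlog : Real.log N ≤ 3 * x := (Real.log_le_iff_le_exp (by positivity)).2 hcube
  rw [Real.logb, div_le_iff₀ (Real.log_pos one_lt_two)]
  nlinarith [Real.log_two_gt_d9]

lemma mul_le_of_mul_pow_le_mul_exp {m : ℕ} (hm : m ≠ 0) {x : ℝ}
    (h : 16 * (8 / 5 : ℝ) ^ m ≤ 25 * Real.exp x) : 3 * m ≤ 128 * x := by
  have hexp : (128 / 125 : ℝ) ^ m ≤ Real.exp x :=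
    calc (128 / 125 : ℝ) ^ m = (16 / 25) ^ m * (8 / 5) ^ m := by rw [← mul_pow]; norm_num
      _ ≤ 16 / 25 * (8 / 5) ^ m := by
        gcongr
        exact pow_le_of_le_one (by norm_num) (by norm_num) hm
      _ ≤ Real.exp x := by linarith
  have hlog : m * Real.log (128 / 125) ≤ x := by
    rw [← Real.log_pow]
    exact (Real.log_le_iff_le_exp (by positivity)).2 hexp
  have hbase : (3 / 128 : ℝ) ≤ Real.log (128 / 125) := by
    linarith [Real.one_sub_inv_le_log_of_pos (show (0 : ℝ) < 128 / 125 by norm_num)]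
  nlinarith [mul_le_mul_of_nonneg_left hbase (Nat.cast_nonneg (α := ℝ) m)]

theorem theorem4 :
    ∃ c₁ > (0 : ℝ), ∃ c₂ > (0 : ℝ),
      ∀ (n k : ℕ) (ε : ℝ), 0 < k → k < n → 0 < ε → ε ≤ 1 / 120 →
      ∀ (Z : ZeroRule n) (Ω : Type*) [MeasurableSpace Ω] (P : Measure Ω) [IsProbabilityMeasure P]
        (alg : Ω → QueryTree n) (q : ℕ),
        (∀ ω, (alg ω).depth ≤ q) →
        LearnsJuntas P Z k ε alg →
        c₁ * (Real.logb 2 (n.choose k : ℝ) / ε ^ 2) + c₂ * ((2 : ℝ) ^ k / ε ^ 2) ≤ (q : ℝ) := by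
  refine ⟨1 / 57600, by norm_num, 1 / 819200, by norm_num, ?_⟩
  intro n k ε hk hkn hε hε' Z Ω _ P _ alg q hq hlearn
  have hchoose : Real.logb 2 (n.choose k) ≤ 6 * (4800 * ε ^ 2 * q) :=
    logb_two_le_of_mul_le_mul_exp (by positivity)
      (choose_le_exp_of_learnsJuntas hk hε hε' hq hlearn)
  have hpow : 3 * ((2 ^ (k - 1) : ℕ) : ℝ) ≤ 128 * (4800 * ε ^ 2 * q) :=
    mul_le_of_mul_pow_le_mul_exp (by positivity)
      (pow_two_pow_le_exp_of_learnsJuntas hk hkn.le hε hε' hq hlearn)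
  have htwo : (2 : ℝ) ^ k = 2 * ((2 ^ (k - 1) : ℕ) : ℝ) := by
    exact_mod_cast (mul_pow_sub_one hk.ne' 2).symm
  have hε2 : 0 < ε ^ 2 := by positivity
  have hchoose' : Real.logb 2 (n.choose k) / ε ^ 2 ≤ 28800 * q := by
    rw [div_le_iff₀ hε2]
    linarith
  have hpow' : (2 : ℝ) ^ k / ε ^ 2 ≤ 409600 * q := by
    rw [div_le_iff₀ hε2]
    linarith
  linarith
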